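/- Let $n\ge 2$. For two parties with $n$ two-outcome measurements each (outcomes $a,b\in\{1,-1\}$, inputs $i,j\in\{1,\dots,n\}$), call $p=\{p(a,b|i,j)\}$ a quantum correlation if there are complex Hilbert spaces $\mathcal H_A,\mathcal H_B$ (of arbitrary, possibly infinite, dimension), a unit vector $|\psi\rangle\in\mathcal H_A\otimes\mathcal H_B$, and self-adjoint operators $A_1,\dots,A_n$ on $\mathcal H_A$ and $B_1,\dots,B_n$ on $\mathcal H_B$ with $A_i^2=\mathbb 1$, $B_j^2=\mathbb 1$, such that $$p(a,b|i,j)=\langle\psi|\,M^a_{A_i}\otimes M^b_{B_j}\,|\psi\rangle ,\qquad M^{a}_{A}=\tfrac12(\mathbb 1+aA),$$ for all $a,b,i,j$. Let $\langle A_iB_j\rangle=\sum_{a,b=\pm1}ab\,p(a,b|i,j)$ and let $$\mathcal I^n_{\mathrm{ch}}(p)=\sum_{i=1}^n\bigl(\langle A_iB_i\rangle+\langle A_{i+1}B_i\rangle\bigr),\qquad A_{n+1}\equiv -A_1,$$ be the chained Bell expression. Then the maximum of $\mathcal I^n_{\mathrm{ch}}$ over all quantum correlations exists and equals $2n\cos\frac{\pi}{2n}$,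 and there is exactly one quantum correlation $p$ attaining this value. It is the one obtained from the two-qubit state $|\phi_+\rangle=\frac1{\sqrt2}(|00\rangle+|11\rangle)$ and the observables $$A_i=\sin\phi_i\,X+\cos\phi_i\,Z,\qquad B_j=\sin\phi'_j\,X+\cos\phi'_j\,Z,\qquad \phi_i=\frac{(i-1)\pi}{n},\quad \phi'_j=\frac{(2j-1)\pi}{2n},$$ where $X$ and $Z$ are the Pauli matrices. -/

import Mathlib

open scoped TensorProduct InnerProductSpace

universe u v

noncomputable section

namespace ChainedBell

/-- A family `p a b i j`, thought of as `p(a, b | i, j)`: the probability of the outcomes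
`a, b ∈ {1, -1}` when the `i`-th measurement of Alice and the `j`-th measurement of Bob are made.
The measurements of each party are numbered `0, …, n - 1`. -/
abbrev Correlation (n : ℕ) : Type := ℤˣ → ℤˣ → Fin n → Fin n → ℝ

section Operators

variable {H : Type u} [NormedAddCommGroup H] [InnerProductSpace ℂ H]
variable {K : Type v} [NormedAddCommGroup K] [InnerProductSpace ℂ K]

/-- A two-outcome observable: a self-adjoint operator with square the identity, that is, a
Hermitian operator all of whose spectrum lies in `{1, -1}`. -/
def IsObservable [CompleteSpace H] (A : H →L[ℂ] H) : Prop :=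
  IsSelfAdjoint A ∧ A * A = 1

/-- The measurement operator `(1 + a A) / 2` for the outcome `a = ±1` of the observable `A`. -/
def outcomeOperator (A : H →L[ℂ] H) (a : ℤˣ) : H →L[ℂ] H :=
  (1 / 2 : ℂ) • (1 + ((a : ℤ) : ℂ) • A)

variable (H K) in
/-- The Hilbert space tensor product of `H` and `K`: the completion of the algebraic tensor product
with respect to the inner product with `⟪x ⊗ y, x' ⊗ y'⟫ = ⟪x, x'⟫ ⟪y, y'⟫`. -/
abbrev HilbertTensor : Type (max u v) := UniformSpace.Completion (H ⊗[ℂ] K)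

/-- The bounded operator `S ⊗ T` on the Hilbert space tensor product. -/
def tensorOperator (S : H →L[ℂ] H) (T : K →L[ℂ] K) : HilbertTensor H K →L[ℂ] HilbertTensor H K :=
  (TensorProduct.mapL S T).completion

/-- The family `p(a, b | i, j) = ⟨ψ| M^a_{A i} ⊗ M^b_{B j} |ψ⟩`. For observables `A i`, `B j` the
inner product is a real number, so that taking the real part only changes the type. -/
def bornCorrelation {n : ℕ} (ψ : HilbertTensor H K) (A : Fin n → H →L[ℂ] H)
    (B : Fin n → K →L[ℂ] K) : Correlation n := fun a b i j =>
  (⟪ψ, tensorOperator (outcomeOperator (A i) a) (outcomeOperator (B j) b) ψ⟫_ℂ).re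

end Operators

/-- The set of quantum correlations with `n` two-outcome measurements for each of two parties: those
given by a unit vector in the tensor product of two Hilbert spaces (of any dimension, finite or
infinite) and by observables of the two parties. -/
def quantumCorrelations (n : ℕ) : Set (Correlation n) :=
  {p | ∃ (H : Type u) (_ : NormedAddCommGroup H) (_ : InnerProductSpace ℂ H) (_ : CompleteSpace H)
      (K : Type v) (_ : NormedAddCommGroup K) (_ : InnerProductSpace ℂ K) (_ : CompleteSpace K)
      (ψ : HilbertTensor H K) (A : Fin n → H →L[ℂ] H) (B : Fin n → K →L[ℂ] K),
      ‖ψ‖ = 1 ∧ (∀ i, IsObservable (A i)) ∧ (∀ j, IsObservable (B j)) ∧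
        p = bornCorrelation ψ A B}

/-- The correlator `⟨A_i B_j⟩ = ∑_{a, b} a b p(a, b | i, j)`. -/
def correlator {n : ℕ} (p : Correlation n) (i j : Fin n) : ℝ :=
  ∑ a : ℤˣ, ∑ b : ℤˣ, ((a : ℤ) : ℝ) * ((b : ℤ) : ℝ) * p a b i j

/-- The left-hand side `∑_i (⟨A_i B_i⟩ + ⟨A_{i+1} B_i⟩)` of the chained Bell inequality, with the
convention that the `A` following the last one is minus the first one. -/
def chainedBellValue {n : ℕ} (p : Correlation n) : ℝ :=
  ∑ i : Fin n, (correlator p i i +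
    if h : (i : ℕ) + 1 < n then correlator p ⟨i + 1, h⟩ i else -correlator p ⟨0, i.pos⟩ i)

/-- The state space of a qubit. -/
abbrev Qubit : Type := EuclideanSpace ℂ (Fin 2)

/-- The Pauli matrix `X`. -/
def pauliX : Matrix (Fin 2) (Fin 2) ℂ := !![0, 1; 1, 0]

/-- The Pauli matrix `Z`. -/
def pauliZ : Matrix (Fin 2) (Fin 2) ℂ := !![1, 0; 0, -1]

/-- The basis vectors `|0⟩` and `|1⟩` of a qubit. -/
def ket (k : Fin 2) : Qubit := EuclideanSpace.single k 1

/-- The maximally entangled state `(|00⟩ + |11⟩) / √2` of two qubits. -/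
def phiPlus : HilbertTensor Qubit Qubit :=
  (((1 / √2 : ℝ) : ℂ) • (ket 0 ⊗ₜ[ℂ] ket 0 + ket 1 ⊗ₜ[ℂ] ket 1) : Qubit ⊗[ℂ] Qubit)

/-- The observable `sin θ X + cos θ Z` of a qubit. -/
def planeObservable (θ : ℝ) : Qubit →L[ℂ] Qubit :=
  Matrix.toEuclideanCLM (𝕜 := ℂ) ((Real.sin θ : ℂ) • pauliX + (Real.cos θ : ℂ) • pauliZ)

/-- Alice's reference observables; with the numbering from `1` the angles are `(i - 1) π / n`. -/
def referenceA (n : ℕ) (i : Fin n) : Qubit →L[ℂ] Qubit :=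
  planeObservable ((i : ℝ) * Real.pi / n)

/-- Bob's reference observables; with the numbering from `1` the angles are `(2 j - 1) π / (2 n)`. -/
def referenceB (n : ℕ) (j : Fin n) : Qubit →L[ℂ] Qubit :=
  planeObservable ((2 * (j : ℝ) + 1) * Real.pi / (2 * n))

/-- The correlations of the reference measurements on the maximally entangled state. -/
def referenceCorrelation (n : ℕ) : Correlation n :=
  bornCorrelation phiPlus (referenceA n) (referenceB n)

end ChainedBell

end

/-! In the state `ψ` put `v (2 * i) = A_i ⊗ 1 ψ` and `v (2 * j + 1) = 1 ⊗ B_j ψ`. With N = 2n and `v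
N = -v 0`, the Bell value is the sum of the N consecutive real inner products of this chain of unit
vectors.

Upper bound: N cos(π/N) minus this sum is a combination, with positive weights, of the squared norms
of the vectors `chainDefect` (`sum_inner_add_sum_chainDefect_of_antiperiodic`).

Uniqueness: at the maximum every defect vanishes, so the chain lies in a plane with consecutive
angles π/N, and this fixes all correlators (`inner_eq_cos_of_sum_inner_eq`). For the marginals,
planarity gives v_k + v_{k+2} = 2cos(π/N) v_{k+1}. The operators behind v_k and v_{k+2} commute with
the one behind v_{k+1}, and by `inner_apply_eq_of_add_eq_smul` they have equal expectations. Going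
once around the chain reverses the sign, so every marginal expectation is zero. Correlators and
marginals determine the correlation.

Attainment is a computation with the maximally entangled state, ⟨S ⊗ T⟩ = ½ ∑ S_kl T_kl. -/

/-! ### Antiperiodic chains of unit vectors in a real inner product space -/

section UnitVectorChain

variable {F : Type*} [NormedAddCommGroup F] [InnerProductSpace ℝ F]

/-- The vector that measures how far `v 0`, `v k`, `v (k + 1)` are from lying in a plane at the
angles `0`, `k θ`, `(k + 1) θ`. -/
noncomputable def chainDefect (v : ℕ → F) (θ : ℝ) (k : ℕ) : F :=
  Real.sin ((k + 1) * θ) • v k - Real.sin (k * θ) • v (k + 1) - Real.sin θ • v 0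

theorem norm_chainDefect_sq (v : ℕ → F) (hv : ∀ k, ‖v k‖ = 1) (θ : ℝ) (k : ℕ) :
    ‖chainDefect v θ k‖ ^ 2 =
      2 * Real.sin (k * θ) * Real.sin ((k + 1) * θ) * (Real.cos θ - ⟪v k, v (k + 1)⟫_ℝ) +
      2 * Real.sin θ * (Real.sin θ - Real.sin ((k + 1) * θ) * ⟪v 0, v k⟫_ℝ +
        Real.sin (k * θ) * ⟪v 0, v (k + 1)⟫_ℝ) := by
  have e : ∀ j, ⟪v j, v j⟫_ℝ = 1 := fun j => by rw [real_inner_self_eq_norm_sq, hv]; norm_num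
  rw [← real_inner_self_eq_norm_sq, chainDefect]
  simp only [inner_sub_left, inner_sub_right, inner_smul_left, inner_smul_right, e,
    RCLike.conj_to_real, real_inner_comm (v 0), real_inner_comm (v k) (v (k + 1))]
  rw [add_mul, one_mul, Real.sin_add]
  linear_combination Real.sin θ ^ 2 * Real.sin_sq_add_cos_sq (k * θ) -
    Real.sin (k * θ) ^ 2 * Real.sin_sq_add_cos_sq θ

/-- Divided by its weight, each squared defect is 2(cos θ - ⟪v k, v (k + 1)⟫) plus differences of
cot(kθ) and of ⟪v 0, v k⟫ / sin(kθ), which telescope. -/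
theorem two_mul_sum_inner_add_sum_chainDefect (v : ℕ → F) (hv : ∀ k, ‖v k‖ = 1) (θ : ℝ) (m : ℕ)
    (hm : 1 ≤ m) (hs : ∀ k : ℕ, 1 ≤ k → k ≤ m → Real.sin (k * θ) ≠ 0) :
    2 * ∑ k ∈ Finset.range m, ⟪v k, v (k + 1)⟫_ℝ +
      ∑ k ∈ Finset.Ico 1 m,
        ‖chainDefect v θ k‖ ^ 2 / (Real.sin (k * θ) * Real.sin ((k + 1) * θ)) =
    2 * m * Real.cos θ - 2 * Real.sin θ * Real.cos (m * θ) / Real.sin (m * θ) +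
      2 * Real.sin θ / Real.sin (m * θ) * ⟪v 0, v m⟫_ℝ := by
  induction m, hm using Nat.le_induction with
  | base =>
    have := hs 1 le_rfl le_rfl
    simp only [Nat.cast_one, one_mul] at this ⊢
    simp
    field_simp
    ring
  | succ m hm ih =>
    have h1 := hs m hm (by omega)
    have h2 := hs (m + 1) (by omega) le_rfl
    rw [Finset.sum_range_succ, Finset.sum_Ico_succ_top hm, norm_chainDefect_sq v hv]
    have ih := ih fun k hk hk' => hs k hk (by omega)
    push_cast at h2 ⊢
    have key : Real.sin θ * Real.cos (m * θ) / Real.sin (m * θ) -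
        Real.sin θ * Real.cos ((m + 1) * θ) / Real.sin ((m + 1) * θ) =
        Real.sin θ ^ 2 / (Real.sin (m * θ) * Real.sin ((m + 1) * θ)) := by
      rw [div_sub_div _ _ h1 h2]
      congr 1
      rw [add_mul, one_mul, Real.sin_add, Real.cos_add]
      linear_combination Real.sin θ ^ 2 * Real.sin_sq_add_cos_sq (m * θ)
    have expand : (2 * Real.sin (m * θ) * Real.sin ((m + 1) * θ) *
          (Real.cos θ - ⟪v m, v (m + 1)⟫_ℝ) +
        2 * Real.sin θ * (Real.sin θ - Real.sin ((m + 1) * θ) * ⟪v 0, v m⟫_ℝ +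
          Real.sin (m * θ) * ⟪v 0, v (m + 1)⟫_ℝ)) /
          (Real.sin (m * θ) * Real.sin ((m + 1) * θ)) =
        2 * (Real.cos θ - ⟪v m, v (m + 1)⟫_ℝ) +
        2 * (Real.sin θ ^ 2 / (Real.sin (m * θ) * Real.sin ((m + 1) * θ))) -
        2 * Real.sin θ / Real.sin (m * θ) * ⟪v 0, v m⟫_ℝ +
        2 * Real.sin θ / Real.sin ((m + 1) * θ) * ⟪v 0, v (m + 1)⟫_ℝ := by
      generalize Real.sin (m * θ) = a at h1 ⊢
      generalize Real.sin ((m + 1) * θ) = b at h2 ⊢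
      field_simp
      ring
    rw [expand]
    linear_combination ih + (-2) * key

theorem sin_mul_pi_div_pos {N k : ℕ} (hk : 1 ≤ k) (hkN : k < N) :
    0 < Real.sin (k * (Real.pi / N)) := by
  have hN : (0 : ℝ) < N := by exact_mod_cast (by omega : 0 < N)
  have hk' : (0 : ℝ) < k := by exact_mod_cast hk
  refine Real.sin_pos_of_pos_of_lt_pi (by positivity) ?_
  rw [mul_div_assoc', div_lt_iff₀ hN, mul_comm]
  exact mul_lt_mul_of_pos_left (by exact_mod_cast hkN) Real.pi_pos

/-- For θ = π/N and m = N - 1 one has sin(mθ) = sin θ, so the boundary term is 2⟪v 0, v (N - 1)⟫; it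
cancels against the last summand, where `v N = -v 0`. -/
theorem sum_inner_add_sum_chainDefect_of_antiperiodic (v : ℕ → F) (hv : ∀ k, ‖v k‖ = 1) {N : ℕ}
    (hN : 2 ≤ N) (hvN : v N = -v 0) :
    2 * ∑ k ∈ Finset.range N, ⟪v k, v (k + 1)⟫_ℝ +
      ∑ k ∈ Finset.Ico 1 (N - 1), ‖chainDefect v (Real.pi / N) k‖ ^ 2 /
        (Real.sin (k * (Real.pi / N)) * Real.sin ((k + 1) * (Real.pi / N))) =
    2 * N * Real.cos (Real.pi / N) := by
  obtain ⟨m, rfl⟩ : ∃ m, N = m + 1 := ⟨N - 1, by omega⟩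
  have key := two_mul_sum_inner_add_sum_chainDefect v hv (Real.pi / (m + 1 : ℕ)) m (by omega)
    fun k hk hkm => (sin_mul_pi_div_pos hk (by omega)).ne'
  have h1 := sin_mul_pi_div_pos (N := m + 1) le_rfl (by omega)
  have h0 : (m : ℝ) * (Real.pi / (m + 1 : ℕ)) = Real.pi - Real.pi / (m + 1 : ℕ) := by
    push_cast; field_simp; ring
  rw [h0, Real.sin_pi_sub, Real.cos_pi_sub] at key
  rw [Nat.cast_one, one_mul] at h1
  rw [Finset.sum_range_succ, hvN, inner_neg_right, real_inner_comm, Nat.add_sub_cancel]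
  generalize ∑ k ∈ Finset.Ico 1 m, ‖chainDefect v (Real.pi / (m + 1 : ℕ)) k‖ ^ 2 /
    (Real.sin (k * (Real.pi / (m + 1 : ℕ))) * Real.sin ((k + 1) * (Real.pi / (m + 1 : ℕ)))) = S
    at key ⊢
  field_simp at key
  push_cast at key ⊢
  linarith

theorem sum_inner_le_of_antiperiodic (v : ℕ → F) (hv : ∀ k, ‖v k‖ = 1) {N : ℕ}
    (hN : 2 ≤ N) (hvN : v N = -v 0) :
    ∑ k ∈ Finset.range N, ⟪v k, v (k + 1)⟫_ℝ ≤ N * Real.cos (Real.pi / N) := by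
  have key := sum_inner_add_sum_chainDefect_of_antiperiodic v hv hN hvN
  have : 0 ≤ ∑ k ∈ Finset.Ico 1 (N - 1), ‖chainDefect v (Real.pi / N) k‖ ^ 2 /
        (Real.sin (k * (Real.pi / N)) * Real.sin ((k + 1) * (Real.pi / N))) := by
    refine Finset.sum_nonneg fun k hk => ?_
    rw [Finset.mem_Ico] at hk
    have h1 := sin_mul_pi_div_pos (N := N) hk.1 (by omega)
    have h2 := sin_mul_pi_div_pos (N := N) (k := k + 1) (by omega) (by omega)
    push_cast at h2
    positivity
  linarith

/-- Equality forces each nonnegatively weighted defect to vanish, and the resulting three-term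
relations give v_{k+1} from v_k and v_0. They reach only k = N - 1; the case k = N is
antiperiodicity. -/
theorem sin_smul_eq_of_sum_inner_eq (v : ℕ → F) (hv : ∀ k, ‖v k‖ = 1) {N : ℕ}
    (hN : 2 ≤ N) (hvN : v N = -v 0)
    (h : ∑ k ∈ Finset.range N, ⟪v k, v (k + 1)⟫_ℝ = N * Real.cos (Real.pi / N)) (k : ℕ)
    (hk : k ≤ N) :
    Real.sin (Real.pi / N) • v k =
      Real.sin (k * (Real.pi / N)) • v 1 - Real.sin ((k - 1) * (Real.pi / N)) • v 0 := by
  have key := sum_inner_add_sum_chainDefect_of_antiperiodic v hv hN hvN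
  have pos : ∀ k ∈ Finset.Ico 1 (N - 1),
      0 < Real.sin (k * (Real.pi / N)) * Real.sin ((k + 1) * (Real.pi / N)) := by
    intro k hk
    rw [Finset.mem_Ico] at hk
    have h1 := sin_mul_pi_div_pos (N := N) hk.1 (by omega)
    have h2 := sin_mul_pi_div_pos (N := N) (k := k + 1) (by omega) (by omega)
    push_cast at h2
    positivity
  have zero : ∀ k ∈ Finset.Ico 1 (N - 1), chainDefect v (Real.pi / N) k = 0 := by
    intro k hk
    have := (Finset.sum_eq_zero_iff_of_nonneg fun k hk => by
      have := pos k hk; positivity).1 (by linarith : ∑ k ∈ Finset.Ico 1 (N - 1),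
        ‖chainDefect v (Real.pi / N) k‖ ^ 2 /
        (Real.sin (k * (Real.pi / N)) * Real.sin ((k + 1) * (Real.pi / N))) = 0) k hk
    rw [div_eq_zero_iff, or_iff_left (pos k hk).ne'] at this
    simpa using this
  have hN0 : (N : ℝ) ≠ 0 := by exact_mod_cast (by omega : N ≠ 0)
  rcases Nat.eq_zero_or_pos k with rfl | hk0
  · simp
  rcases hk.lt_or_eq with hkN | rfl
  · induction k, hk0 using Nat.le_induction with
    | base => simp
    | succ k hk1 ih =>
      have hk1 : 1 ≤ k := hk1
      have ih := ih (by omega) (by omega)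
      have hz := zero k (Finset.mem_Ico.2 ⟨hk1, by omega⟩)
      have hs := (sin_mul_pi_div_pos (N := N) hk1 (by omega)).ne'
      rw [chainDefect, sub_sub, sub_eq_zero] at hz
      refine smul_right_injective F hs ?_
      simp only [smul_sub, smul_smul]
      have e1 : (Real.sin (k * (Real.pi / N)) * Real.sin (Real.pi / N)) • v (k + 1) =
          Real.sin (Real.pi / N) • (Real.sin ((k + 1) * (Real.pi / N)) • v k -
            Real.sin (Real.pi / N) • v 0) := by
        rw [hz]; module
      have e2 : Real.sin (Real.pi / N) • (Real.sin ((k + 1) * (Real.pi / N)) • v k -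
            Real.sin (Real.pi / N) • v 0) = Real.sin ((k + 1) * (Real.pi / N)) •
            (Real.sin (Real.pi / N) • v k) - (Real.sin (Real.pi / N) ^ 2) • v 0 := by module
      rw [e1, e2, ih]
      push_cast
      have e3 : Real.sin ((k + 1) * (Real.pi / N)) * Real.sin ((k - 1) * (Real.pi / N)) +
          Real.sin (Real.pi / N) ^ 2 = Real.sin (k * (Real.pi / N)) ^ 2 := by
        rw [add_mul, sub_mul, one_mul, Real.sin_add, Real.sin_sub]
        linear_combination Real.sin (k * (Real.pi / N)) ^ 2 *
          Real.sin_sq_add_cos_sq (Real.pi / N) -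
          Real.sin (Real.pi / N) ^ 2 * Real.sin_sq_add_cos_sq (k * (Real.pi / N))
      rw [add_sub_cancel_right, ← sq, ← e3]
      module
  · have e1 : (k : ℝ) * (Real.pi / k) = Real.pi := by field_simp
    rw [sub_mul, e1, one_mul, Real.sin_pi_sub, hvN, Real.sin_pi]
    module

theorem inner_eq_cos_of_sum_inner_eq (v : ℕ → F) (hv : ∀ k, ‖v k‖ = 1) {N : ℕ}
    (hN : 3 ≤ N) (hvN : v N = -v 0)
    (h : ∑ k ∈ Finset.range N, ⟪v k, v (k + 1)⟫_ℝ = N * Real.cos (Real.pi / N)) (j k : ℕ)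
    (hj : j ≤ N) (hk : k ≤ N) :
    ⟪v j, v k⟫_ℝ = Real.cos ((j - k) * (Real.pi / N)) := by
  have e : ∀ j, ⟪v j, v j⟫_ℝ = 1 := fun j => by rw [real_inner_self_eq_norm_sq, hv]; norm_num
  have expl := sin_smul_eq_of_sum_inner_eq v hv (by omega) hvN h
  have hs : 0 < Real.sin (Real.pi / N) := by
    simpa using sin_mul_pi_div_pos (N := N) (k := 1) le_rfl (by omega)
  have hs2 : 0 < Real.sin (2 * (Real.pi / N)) := by
    simpa using sin_mul_pi_div_pos (N := N) (k := 2) (by omega) (by omega)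
  have hc : 0 < Real.cos (Real.pi / N) := by
    rw [Real.sin_two_mul] at hs2
    exact pos_of_mul_pos_right hs2 (by positivity)
  have gram : ∀ j k : ℕ, j ≤ N → k ≤ N → Real.sin (Real.pi / N) ^ 2 * ⟪v j, v k⟫_ℝ =
      Real.sin (j * (Real.pi / N)) * Real.sin (k * (Real.pi / N)) +
      Real.sin ((j - 1) * (Real.pi / N)) * Real.sin ((k - 1) * (Real.pi / N)) -
      (Real.sin (j * (Real.pi / N)) * Real.sin ((k - 1) * (Real.pi / N)) +
      Real.sin ((j - 1) * (Real.pi / N)) * Real.sin (k * (Real.pi / N))) * ⟪v 0, v 1⟫_ℝ := by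
    intro j k hj hk
    have : Real.sin (Real.pi / N) ^ 2 * ⟪v j, v k⟫_ℝ =
        ⟪Real.sin (Real.pi / N) • v j, Real.sin (Real.pi / N) • v k⟫_ℝ := by
      rw [real_inner_smul_left, real_inner_smul_right]; ring
    rw [this, expl j hj, expl k hk]
    simp only [inner_sub_left, inner_sub_right, inner_smul_left, inner_smul_right, e,
      RCLike.conj_to_real, real_inner_comm (v 0)]
    ring
  -- The unit norm of `v 2` fixes the remaining unknown; cancelling sin(2π/N) is where N ≥ 3 enters.
  have h01 : ⟪v 0, v 1⟫_ℝ = Real.cos (Real.pi / N) := by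
    have := gram 2 2 (by omega) (by omega)
    rw [e] at this
    push_cast at this
    rw [Real.sin_two_mul, (by ring : ((2 : ℝ) - 1) * (Real.pi / N) = Real.pi / N)] at this
    have h4 : Real.sin (Real.pi / N) ^ 2 * Real.cos (Real.pi / N) ≠ 0 := by positivity
    refine mul_left_cancel₀ h4 ?_
    linarith
  refine mul_left_cancel₀ (pow_ne_zero 2 hs.ne') ?_
  rw [gram j k hj hk, h01]
  simp only [sub_mul, one_mul, Real.sin_sub, Real.cos_sub]
  linear_combination -(Real.sin (j * (Real.pi / N)) * Real.sin (k * (Real.pi / N))) *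
    Real.sin_sq_add_cos_sq (Real.pi / N)

theorem add_eq_two_mul_cos_smul_of_sum_inner_eq (v : ℕ → F) (hv : ∀ k, ‖v k‖ = 1) {N : ℕ}
    (hN : 2 ≤ N) (hvN : v N = -v 0)
    (h : ∑ k ∈ Finset.range N, ⟪v k, v (k + 1)⟫_ℝ = N * Real.cos (Real.pi / N)) (k : ℕ)
    (hk : k + 2 ≤ N) :
    v k + v (k + 2) = (2 * Real.cos (Real.pi / N)) • v (k + 1) := by
  have expl := sin_smul_eq_of_sum_inner_eq v hv hN hvN h
  have hs : 0 < Real.sin (Real.pi / N) := by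
    simpa using sin_mul_pi_div_pos (N := N) (k := 1) le_rfl (by omega)
  refine smul_right_injective F hs.ne' ?_
  beta_reduce
  simp only [smul_add]
  rw [smul_comm, expl k (by omega), expl (k + 1) (by omega), expl (k + 2) (by omega)]
  push_cast
  have e1 : ∀ x : ℝ, Real.sin ((x + 1) * (Real.pi / N)) + Real.sin ((x - 1) * (Real.pi / N)) =
      2 * Real.cos (Real.pi / N) * Real.sin (x * (Real.pi / N)) := by
    intro x
    rw [add_mul, sub_mul, one_mul, Real.sin_add, Real.sin_sub]
    ring
  have h1 := e1 (k + 1)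
  have h2 := e1 k
  rw [add_sub_cancel_right] at h1 ⊢
  rw [add_assoc, one_add_one_eq_two] at h1
  rw [smul_sub, smul_smul, smul_smul, ← h1, ← h2,
    (by ring : (k : ℝ) + 2 - 1 = k + 1)]
  module

/-- The same recurrence across the seam, where the predecessor of `v 0` is `-v (N - 1)`. -/
theorem one_sub_last_eq_two_mul_cos_smul_of_sum_inner_eq (v : ℕ → F) (hv : ∀ k, ‖v k‖ = 1) {N : ℕ}
    (hN : 2 ≤ N) (hvN : v N = -v 0)
    (h : ∑ k ∈ Finset.range N, ⟪v k, v (k + 1)⟫_ℝ = N * Real.cos (Real.pi / N)) :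
    v 1 - v (N - 1) = (2 * Real.cos (Real.pi / N)) • v 0 := by
  have expl := sin_smul_eq_of_sum_inner_eq v hv hN hvN h
  have hs : 0 < Real.sin (Real.pi / N) := by
    simpa using sin_mul_pi_div_pos (N := N) (k := 1) le_rfl (by omega)
  have hN0 : (N : ℝ) ≠ 0 := by exact_mod_cast (by omega : N ≠ 0)
  refine smul_right_injective F hs.ne' ?_
  beta_reduce
  simp only [smul_sub]
  rw [expl (N - 1) (by omega)]
  have e1 : ((N - 1 : ℕ) : ℝ) = N - 1 := by push_cast [Nat.cast_sub (by omega : 1 ≤ N)]; rfl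
  have e2 : ((N : ℝ) - 1) * (Real.pi / N) = Real.pi - Real.pi / N := by field_simp
  have e3 : ((N : ℝ) - 1 - 1) * (Real.pi / N) = Real.pi - 2 * (Real.pi / N) := by field_simp; ring
  rw [e1, e2, e3, Real.sin_pi_sub, Real.sin_pi_sub, Real.sin_two_mul]
  module

end UnitVectorChain

noncomputable section

namespace ChainedBell

/-! ### Algebra of operators on the completed tensor product, by density of the algebraic one -/

section TensorOperator

variable {H : Type u} [NormedAddCommGroup H] [InnerProductSpace ℂ H]
variable {K : Type v} [NormedAddCommGroup K] [InnerProductSpace ℂ K]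

@[simp]
theorem tensorOperator_coe (S : H →L[ℂ] H) (T : K →L[ℂ] K) (z : H ⊗[ℂ] K) :
    tensorOperator S T (z : HilbertTensor H K) = (TensorProduct.mapL S T z : H ⊗[ℂ] K) :=
  ContinuousLinearMap.completion_apply_coe _ _

theorem hilbertTensor_operator_ext {f g : HilbertTensor H K →L[ℂ] HilbertTensor H K}
    (h : ∀ z : H ⊗[ℂ] K, f z = g z) : f = g :=
  ContinuousLinearMap.ext fun z => UniformSpace.Completion.induction_on z
    (isClosed_eq f.continuous g.continuous) h

theorem tensorOperator_add_left (S S' : H →L[ℂ] H) (T : K →L[ℂ] K) :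
    tensorOperator (S + S') T = tensorOperator S T + tensorOperator S' T :=
  hilbertTensor_operator_ext fun z => by
    rw [_root_.add_apply]
    simp only [tensorOperator_coe, TensorProduct.mapL_add_left, _root_.add_apply,
      UniformSpace.Completion.coe_add]

theorem tensorOperator_add_right (S : H →L[ℂ] H) (T T' : K →L[ℂ] K) :
    tensorOperator S (T + T') = tensorOperator S T + tensorOperator S T' :=
  hilbertTensor_operator_ext fun z => by
    rw [_root_.add_apply]
    simp only [tensorOperator_coe, TensorProduct.mapL_add_right, _root_.add_apply,
      UniformSpace.Completion.coe_add]

theorem tensorOperator_smul_left (c : ℂ) (S : H →L[ℂ] H) (T : K →L[ℂ] K) :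
    tensorOperator (c • S) T = c • tensorOperator S T :=
  hilbertTensor_operator_ext fun z => by
    rw [_root_.smul_apply]
    simp only [tensorOperator_coe, TensorProduct.mapL_smul_left, _root_.smul_apply,
      UniformSpace.Completion.coe_smul]

theorem tensorOperator_smul_right (c : ℂ) (S : H →L[ℂ] H) (T : K →L[ℂ] K) :
    tensorOperator S (c • T) = c • tensorOperator S T :=
  hilbertTensor_operator_ext fun z => by
    rw [_root_.smul_apply]
    simp only [tensorOperator_coe, TensorProduct.mapL_smul_right, _root_.smul_apply,
      UniformSpace.Completion.coe_smul]

theorem tensorOperator_mul (S S' : H →L[ℂ] H) (T T' : K →L[ℂ] K) :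
    tensorOperator (S * S') (T * T') = tensorOperator S T * tensorOperator S' T' :=
  hilbertTensor_operator_ext fun z => by
    rw [_root_.mul_apply_eq_comp]
    simp only [tensorOperator_coe, TensorProduct.mapL_mul, _root_.mul_apply_eq_comp]

@[simp]
theorem tensorOperator_one : tensorOperator (1 : H →L[ℂ] H) (1 : K →L[ℂ] K) = 1 :=
  hilbertTensor_operator_ext fun z => by
    rw [tensorOperator_coe]
    exact congrArg _ (congrArg (· z) TensorProduct.mapL_id_id)

theorem tensorOperator_isSymmetric {S : H →L[ℂ] H} {T : K →L[ℂ] K}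
    (hS : (S : H →ₗ[ℂ] H).IsSymmetric) (hT : (T : K →ₗ[ℂ] K).IsSymmetric) :
    (tensorOperator S T : HilbertTensor H K →ₗ[ℂ] HilbertTensor H K).IsSymmetric := by
  intro x y
  refine UniformSpace.Completion.induction_on₂ x y (isClosed_eq ?_ ?_) fun x y => ?_
  · exact Continuous.inner ((tensorOperator S T).continuous.comp continuous_fst) continuous_snd
  · exact Continuous.inner continuous_fst ((tensorOperator S T).continuous.comp continuous_snd)
  · simp only [ContinuousLinearMap.coe_coe, tensorOperator_coe, UniformSpace.Completion.inner_coe]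
    induction x with
    | zero => simp
    | add x x' hx hx' => simp only [map_add, inner_add_left, hx, hx']
    | tmul a b =>
      induction y with
      | zero => simp
      | add y y' hy hy' => simp only [map_add, inner_add_right, hy, hy']
      | tmul c d =>
        simp only [TensorProduct.mapL_tmul, TensorProduct.inner_tmul]
        exact congrArg₂ _ (hS a c) (hT b d)

end TensorOperator

/-! ### Symmetric involutions and equality of expectations -/

section Involutions

variable {E : Type*} [NormedAddCommGroup E] [InnerProductSpace ℂ E]

/-- A symmetric operator with square the identity. -/
structure IsSymmetricInvolution (P : E →L[ℂ] E) : Prop where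
  isSymmetric : (P : E →ₗ[ℂ] E).IsSymmetric
  mul_self : P * P = 1

theorem IsSymmetricInvolution.inner_apply_left {P : E →L[ℂ] E} (hP : IsSymmetricInvolution P)
    (x y : E) : ⟪P x, y⟫_ℂ = ⟪x, P y⟫_ℂ := hP.isSymmetric x y

theorem IsSymmetricInvolution.apply_apply {P : E →L[ℂ] E} (hP : IsSymmetricInvolution P)
    (x : E) : P (P x) = x := congrArg (· x) hP.mul_self

theorem IsSymmetricInvolution.neg {P : E →L[ℂ] E} (hP : IsSymmetricInvolution P) :
    IsSymmetricInvolution (-P) :=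
  ⟨fun x y => by
    simp only [ContinuousLinearMap.coe_coe, _root_.neg_apply, inner_neg_left,
      inner_neg_right, hP.inner_apply_left], by rw [neg_mul_neg, hP.mul_self]⟩

theorem IsSymmetricInvolution.norm_apply {P : E →L[ℂ] E} (hP : IsSymmetricInvolution P) (x : E) :
    ‖P x‖ = ‖x‖ := by
  rw [@norm_eq_sqrt_re_inner ℂ, @norm_eq_sqrt_re_inner ℂ, hP.inner_apply_left, hP.apply_apply]

/-- If `P ψ + Q ψ` is a nonzero real multiple of `V ψ` with `V` commuting with `P` and `Q`, then
`P` and `Q` have the same expectation in `ψ`, because `P + Q` and `P - Q` anticommute. -/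
theorem inner_apply_eq_of_add_eq_smul {P Q V : E →L[ℂ] E} (hP : IsSymmetricInvolution P)
    (hQ : IsSymmetricInvolution Q) (hV : IsSymmetricInvolution V)
    (hVP : ∀ x, V (P x) = P (V x)) (hVQ : ∀ x, V (Q x) = Q (V x)) {ψ : E} {c : ℝ} (hc : c ≠ 0)
    (h : P ψ + Q ψ = (c : ℂ) • V ψ) : ⟪ψ, P ψ⟫_ℂ = ⟪ψ, Q ψ⟫_ℂ := by
  -- With S = P + Q and D = P - Q, the number ⟪Dψ, S²ψ⟫ is evaluated twice. From S²ψ = c²ψ it is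
  -- c²⟪ψ, Dψ⟫; moving one S to the left and using SD = -DS and Sψ = cVψ, it is -c²⟪ψ, Dψ⟫.
  have hSS : P (P ψ + Q ψ) + Q (P ψ + Q ψ) = ((c : ℂ) ^ 2) • ψ := by
    rw [h, map_smul, map_smul, ← hVP, ← hVQ, ← smul_add, ← map_add, h, map_smul, hV.apply_apply,
      smul_smul, sq]
  have e1 : (c : ℂ) ^ 2 * ⟪ψ, P ψ - Q ψ⟫_ℂ =
      ⟪P ψ - Q ψ, P (P ψ + Q ψ) + Q (P ψ + Q ψ)⟫_ℂ := by
    rw [hSS, inner_smul_right, inner_sub_left, inner_sub_right, hP.inner_apply_left,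
      hQ.inner_apply_left]
  have e2 : ⟪P ψ - Q ψ, P (P ψ + Q ψ) + Q (P ψ + Q ψ)⟫_ℂ =
      ⟪P (P ψ - Q ψ) + Q (P ψ - Q ψ), P ψ + Q ψ⟫_ℂ := by
    rw [inner_add_right, ← hP.inner_apply_left, ← hQ.inner_apply_left, ← inner_add_left]
  have e3 : P (P ψ - Q ψ) + Q (P ψ - Q ψ) = -(P (P ψ + Q ψ) - Q (P ψ + Q ψ)) := by
    simp only [map_sub, map_add, hP.apply_apply, hQ.apply_apply]; abel
  have e4 : ⟪P (P ψ - Q ψ) + Q (P ψ - Q ψ), P ψ + Q ψ⟫_ℂ = -((c : ℂ) ^ 2 * ⟪ψ, P ψ - Q ψ⟫_ℂ) := by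
    rw [e3, h, map_smul, map_smul, ← hVP, ← hVQ, ← smul_sub, ← map_sub, inner_neg_left,
      inner_smul_left, inner_smul_right, hV.inner_apply_left, hV.apply_apply, inner_sub_left,
      hP.inner_apply_left, hQ.inner_apply_left, inner_sub_right, Complex.conj_ofReal]
    ring
  rw [← e1, e4] at e2
  have hc2 : (c : ℂ) ^ 2 ≠ 0 := pow_ne_zero 2 (by exact_mod_cast hc)
  have : (c : ℂ) ^ 2 * ⟪ψ, P ψ - Q ψ⟫_ℂ = 0 := by linear_combination e2 / 2
  rw [mul_eq_zero, or_iff_right hc2, inner_sub_right, sub_eq_zero] at this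
  exact this

end Involutions

/-! ### Interlacing the two parties into one chain -/

section Interlace

variable {F : Type*} [NormedAddCommGroup F] [InnerProductSpace ℝ F]

/-- The sequence `x 0, y 0, x 1, y 1, …, x (n - 1), y (n - 1), -x 0, …`. -/
def interlace {F : Type*} [Neg F] {n : ℕ} (hn : 0 < n) (x y : Fin n → F) (k : ℕ) : F :=
  if Even k then if h : k / 2 < n then x ⟨k / 2, h⟩ else -x ⟨0, hn⟩
  else if h : k / 2 < n then y ⟨k / 2, h⟩ else y ⟨0, hn⟩

theorem interlace_two_mul {F : Type*} [Neg F] {n : ℕ} (hn : 0 < n) (x y : Fin n → F) (i : ℕ) :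
    interlace hn x y (2 * i) = if h : i < n then x ⟨i, h⟩ else -x ⟨0, hn⟩ := by
  have : 2 * i / 2 = i := by omega
  simp only [interlace, even_two_mul, if_true, this]

theorem interlace_two_mul_add_one {F : Type*} [Neg F] {n : ℕ} (hn : 0 < n) (x y : Fin n → F)
    (i : Fin n) : interlace hn x y (2 * (i : ℕ) + 1) = y i := by
  have : (2 * (i : ℕ) + 1) / 2 = i := by omega
  have h2 : ¬ Even (2 * (i : ℕ) + 1) := by simp
  simp only [interlace, h2, if_false, this, i.isLt, dite_true]

theorem interlace_fin {F : Type*} [Neg F] {n : ℕ} (hn : 0 < n) (x y : Fin n → F) (i : Fin n) :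
    interlace hn x y (2 * (i : ℕ)) = x i := by
  rw [interlace_two_mul, dif_pos i.isLt]

theorem interlace_antiperiodic {F : Type*} [Neg F] {n : ℕ} (hn : 0 < n) (x y : Fin n → F) :
    interlace hn x y (2 * n) = -interlace hn x y 0 := by
  rw [interlace_two_mul, dif_neg (lt_irrefl n)]
  exact congrArg _ (interlace_fin hn x y ⟨0, hn⟩).symm

theorem sum_inner_interlace {n : ℕ} (hn : 0 < n) (x y : Fin n → F) :
    ∑ k ∈ Finset.range (2 * n), ⟪interlace hn x y k, interlace hn x y (k + 1)⟫_ℝ =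
      ∑ i : Fin n, (⟪x i, y i⟫_ℝ +
        if h : (i : ℕ) + 1 < n then ⟪x ⟨i + 1, h⟩, y i⟫_ℝ else -⟪x ⟨0, i.pos⟩, y i⟫_ℝ) := by
  have pairs : ∀ (f : ℕ → ℝ) (m : ℕ), ∑ k ∈ Finset.range (2 * m), f k =
      ∑ i ∈ Finset.range m, (f (2 * i) + f (2 * i + 1)) := by
    intro f m
    induction m with
    | zero => simp
    | succ m ih => rw [Finset.sum_range_succ, ← ih, mul_add, mul_one, Finset.sum_range_succ,
        Finset.sum_range_succ, add_assoc]
  rw [pairs, ← Fin.sum_univ_eq_sum_range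
    (fun i => ⟪interlace hn x y (2 * i), interlace hn x y (2 * i + 1)⟫_ℝ +
      ⟪interlace hn x y (2 * i + 1), interlace hn x y (2 * i + 1 + 1)⟫_ℝ)]
  refine Finset.sum_congr rfl fun i _ => ?_
  rw [interlace_fin, interlace_two_mul_add_one, (by ring : 2 * (i : ℕ) + 1 + 1 = 2 * (i + 1)),
    interlace_two_mul]
  split_ifs
  · rw [real_inner_comm (y i), real_inner_comm (y i)]
  · rw [inner_neg_right, real_inner_comm (y i), real_inner_comm (y i)]

end Interlace

/-! ### The chained expression for two families of involutions -/

section Involutions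

variable {E : Type*} [NormedAddCommGroup E] [InnerProductSpace ℂ E] {n : ℕ}
  {P Q : Fin n → E →L[ℂ] E}

/-- Interlacing operators keeps the algebra and interlacing vectors feeds the chain estimates; this
passes between the two. -/
theorem interlace_apply (hn : 0 < n) (P Q : Fin n → E →L[ℂ] E) (k : ℕ) (ψ : E) :
    interlace hn P Q k ψ = interlace hn (fun i => P i ψ) (fun j => Q j ψ) k := by
  unfold interlace
  split_ifs <;> rfl

/-- Also true past index 2n, where the filler values are again signed members of the families; the
chain lemmas require unit norm at every index. -/
theorem isSymmetricInvolution_interlace (hn : 0 < n) (hP : ∀ i, IsSymmetricInvolution (P i))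
    (hQ : ∀ j, IsSymmetricInvolution (Q j)) (k : ℕ) :
    IsSymmetricInvolution (interlace hn P Q k) := by
  unfold interlace
  split_ifs
  exacts [hP _, (hP _).neg, hQ _, hQ _]

theorem commute_interlace (hn : 0 < n) (hPQ : ∀ i j, Commute (P i) (Q j)) {k l : ℕ}
    (hkl : Even k ↔ ¬ Even l) : Commute (interlace hn P Q k) (interlace hn P Q l) := by
  unfold interlace
  split_ifs <;> first
    | tauto
    | exact hPQ _ _
    | exact (hPQ _ _).symm
    | exact (hPQ _ _).neg_left
    | exact (hPQ _ _).symm.neg_right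

/-- The chained expression of the expectations of the products `P i * Q j` in the state `ψ`. -/
def chainedSum (P Q : Fin n → E →L[ℂ] E) (ψ : E) : ℝ :=
  ∑ i : Fin n, ((⟪P i ψ, Q i ψ⟫_ℂ).re +
    if h : (i : ℕ) + 1 < n then (⟪P ⟨i + 1, h⟩ ψ, Q i ψ⟫_ℂ).re
    else -(⟪P ⟨0, i.pos⟩ ψ, Q i ψ⟫_ℂ).re)

attribute [local instance] InnerProductSpace.complexToReal

/-- The real inner product is the real part of the complex one, so the real chain estimates apply to
`ψ`. -/
theorem sum_inner_interlace_apply (hn : 0 < n) (P Q : Fin n → E →L[ℂ] E) (ψ : E) :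
    ∑ k ∈ Finset.range (2 * n), ⟪interlace hn P Q k ψ, interlace hn P Q (k + 1) ψ⟫_ℝ =
      chainedSum P Q ψ := by
  simp only [interlace_apply]
  exact sum_inner_interlace hn (fun i => P i ψ) (fun j => Q j ψ)

theorem interlace_apply_antiperiodic (hn : 0 < n) (P Q : Fin n → E →L[ℂ] E) (ψ : E) :
    interlace hn P Q (2 * n) ψ = -interlace hn P Q 0 ψ := by
  rw [interlace_antiperiodic]
  rfl

theorem chainedSum_le (hn : 0 < n) (hP : ∀ i, IsSymmetricInvolution (P i))
    (hQ : ∀ j, IsSymmetricInvolution (Q j)) {ψ : E} (hψ : ‖ψ‖ = 1) :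
    chainedSum P Q ψ ≤ 2 * n * Real.cos (Real.pi / (2 * n)) := by
  rw [← sum_inner_interlace_apply hn]
  have := sum_inner_le_of_antiperiodic (N := 2 * n) (fun k => interlace hn P Q k ψ)
    (fun k => by rw [(isSymmetricInvolution_interlace hn hP hQ k).norm_apply, hψ]) (by omega)
    (interlace_apply_antiperiodic hn P Q ψ)
  exact_mod_cast this

section Maximal

variable (hn : 2 ≤ n) (hP : ∀ i, IsSymmetricInvolution (P i))
  (hQ : ∀ j, IsSymmetricInvolution (Q j)) {ψ : E} (hψ : ‖ψ‖ = 1)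
  (h : chainedSum P Q ψ = 2 * n * Real.cos (Real.pi / (2 * n)))

include hn hP hQ hψ h

theorem re_inner_apply_apply_of_chainedSum_eq (i j : Fin n) :
    (⟪P i ψ, Q j ψ⟫_ℂ).re =
      Real.cos ((2 * (i : ℝ) - (2 * (j : ℝ) + 1)) * (Real.pi / (2 * n))) := by
  have hn0 : 0 < n := by omega
  rw [← sum_inner_interlace_apply hn0] at h
  have := inner_eq_cos_of_sum_inner_eq (N := 2 * n) (fun k => interlace hn0 P Q k ψ)
    (fun k => by rw [(isSymmetricInvolution_interlace hn0 hP hQ k).norm_apply, hψ]) (by omega)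
    (interlace_apply_antiperiodic hn0 P Q ψ) (by exact_mod_cast h) (2 * i) (2 * j + 1)
    (by omega) (by omega)
  rw [interlace_fin, interlace_two_mul_add_one] at this
  push_cast at this
  exact this

variable (hPQ : ∀ i j, Commute (P i) (Q j))

include hPQ

theorem inner_interlace_apply_of_chainedSum_eq (hn0 : 0 < n) (k : ℕ) (hk : k < 2 * n) :
    ⟪ψ, interlace hn0 P Q k ψ⟫_ℂ = 0 := by
  rw [← sum_inner_interlace_apply hn0] at h
  replace h : ∑ k ∈ Finset.range (2 * n),
      ⟪interlace hn0 P Q k ψ, interlace hn0 P Q (k + 1) ψ⟫_ℝ =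
      ((2 * n : ℕ) : ℝ) * Real.cos (Real.pi / (2 * n : ℕ)) := by exact_mod_cast h
  have hv : ∀ k, ‖interlace hn0 P Q k ψ‖ = 1 := fun k => by
    rw [(isSymmetricInvolution_interlace hn0 hP hQ k).norm_apply, hψ]
  have hanti := interlace_apply_antiperiodic hn0 P Q ψ
  have hinv := isSymmetricInvolution_interlace hn0 hP hQ
  have hcomm : ∀ k l : ℕ, (Even k ↔ ¬ Even l) → ∀ x, interlace hn0 P Q k (interlace hn0 P Q l x) =
      interlace hn0 P Q l (interlace hn0 P Q k x) := fun k l hkl x =>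
    congrArg (· x) (commute_interlace hn0 hPQ hkl).eq
  -- Here n ≥ 2 keeps the angle strictly below π/2.
  have hc : 2 * Real.cos (Real.pi / (2 * n : ℕ)) ≠ 0 := by
    have hn' : (2 : ℝ) ≤ n := by exact_mod_cast hn
    refine mul_ne_zero two_ne_zero (Real.cos_pos_of_mem_Ioo ⟨?_, ?_⟩).ne'
    · have : 0 < Real.pi / (2 * n : ℕ) := by have := Real.pi_pos; positivity
      linarith [Real.pi_pos]
    · push_cast
      exact div_lt_div_of_pos_left Real.pi_pos two_pos (by linarith)
  have step : ∀ k, k + 2 ≤ 2 * n →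
      ⟪ψ, interlace hn0 P Q k ψ⟫_ℂ = ⟪ψ, interlace hn0 P Q (k + 2) ψ⟫_ℂ := fun k hk =>
    inner_apply_eq_of_add_eq_smul (hinv k) (hinv (k + 2)) (hinv (k + 1))
      (hcomm _ _ (by grind)) (hcomm _ _ (by grind)) hc
      (add_eq_two_mul_cos_smul_of_sum_inner_eq (fun k => interlace hn0 P Q k ψ) hv (by omega)
        hanti h k hk)
  -- Steps of two preserve parity, and the odd indices stop at 2n - 1; this relation closes their
  -- loop with a sign. The even loop closes by antiperiodicity at 2n.
  have wrap : ⟪ψ, interlace hn0 P Q 1 ψ⟫_ℂ = ⟪ψ, (-interlace hn0 P Q (2 * n - 1)) ψ⟫_ℂ :=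
    inner_apply_eq_of_add_eq_smul (hinv 1) (hinv (2 * n - 1)).neg (hinv 0)
      (hcomm _ _ (by grind)) (fun x => by
        simp only [_root_.neg_apply, map_neg]
        rw [hcomm 0 (2 * n - 1) (by grind)]) hc
      ((sub_eq_add_neg _ _).symm.trans
        (one_sub_last_eq_two_mul_cos_smul_of_sum_inner_eq (fun k => interlace hn0 P Q k ψ) hv
          (by omega) hanti h))
  rw [_root_.neg_apply, inner_neg_right] at wrap
  have even : ∀ i : ℕ, 2 * i ≤ 2 * n →
      ⟪ψ, interlace hn0 P Q (2 * i) ψ⟫_ℂ = ⟪ψ, interlace hn0 P Q 0 ψ⟫_ℂ := by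
    intro i
    induction i with
    | zero => simp
    | succ i ih => intro hi; rw [← ih (by omega), step (2 * i) (by omega), mul_add, mul_one]
  have odd : ∀ i : ℕ, 2 * i + 1 ≤ 2 * n →
      ⟪ψ, interlace hn0 P Q (2 * i + 1) ψ⟫_ℂ = ⟪ψ, interlace hn0 P Q 1 ψ⟫_ℂ := by
    intro i
    induction i with
    | zero => simp
    | succ i ih =>
      intro hi; rw [← ih (by omega), step (2 * i + 1) (by omega), mul_add, mul_one, add_right_comm]
  rcases Nat.even_or_odd' k with ⟨i, rfl | rfl⟩
  · have := even n le_rfl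
    rw [hanti, inner_neg_right] at this
    rw [even i hk.le]
    exact self_eq_neg.1 this.symm
  · have := odd (n - 1) (by omega)
    rw [(by omega : 2 * (n - 1) + 1 = 2 * n - 1)] at this
    rw [this] at wrap
    rw [odd i hk.le]
    exact self_eq_neg.1 wrap

theorem inner_apply_left_of_chainedSum_eq (i : Fin n) : ⟪ψ, P i ψ⟫_ℂ = 0 := by
  have := inner_interlace_apply_of_chainedSum_eq hn hP hQ hψ h hPQ (by omega) (2 * i) (by omega)
  rwa [interlace_fin] at this

theorem inner_apply_right_of_chainedSum_eq (j : Fin n) : ⟪ψ, Q j ψ⟫_ℂ = 0 := by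
  have := inner_interlace_apply_of_chainedSum_eq hn hP hQ hψ h hPQ (by omega) (2 * j + 1)
    (by omega)
  rwa [interlace_two_mul_add_one] at this

end Maximal

end Involutions

/-! ### From the Born rule to expectations of commuting involutions -/

section Born

variable {H : Type u} [NormedAddCommGroup H] [InnerProductSpace ℂ H]
variable {K : Type v} [NormedAddCommGroup K] [InnerProductSpace ℂ K]

variable (K) in
theorem IsObservable.isSymmetricInvolution_left [CompleteSpace H] {A : H →L[ℂ] H}
    (hA : IsObservable A) : IsSymmetricInvolution (tensorOperator A (1 : K →L[ℂ] K)) :=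
  ⟨tensorOperator_isSymmetric hA.1.isSymmetric fun _ _ => rfl,
    by rw [← tensorOperator_mul, hA.2, one_mul, tensorOperator_one]⟩

variable (H) in
theorem IsObservable.isSymmetricInvolution_right [CompleteSpace K] {B : K →L[ℂ] K}
    (hB : IsObservable B) : IsSymmetricInvolution (tensorOperator (1 : H →L[ℂ] H) B) :=
  ⟨tensorOperator_isSymmetric (fun _ _ => rfl) hB.1.isSymmetric,
    by rw [← tensorOperator_mul, hB.2, one_mul, tensorOperator_one]⟩

theorem commute_tensorOperator (A : H →L[ℂ] H) (B : K →L[ℂ] K) :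
    Commute (tensorOperator A (1 : K →L[ℂ] K)) (tensorOperator (1 : H →L[ℂ] H) B) := by
  rw [Commute, SemiconjBy, ← tensorOperator_mul, ← tensorOperator_mul, one_mul, one_mul, mul_one,
    mul_one]

theorem tensorOperator_outcomeOperator (A : H →L[ℂ] H) (B : K →L[ℂ] K) (a b : ℤˣ) :
    tensorOperator (outcomeOperator A a) (outcomeOperator B b) =
      (1 / 4 : ℂ) • (1 + ((a : ℤ) : ℂ) • tensorOperator A 1 + ((b : ℤ) : ℂ) • tensorOperator 1 B +
        (((a : ℤ) : ℂ) * ((b : ℤ) : ℂ)) • (tensorOperator A 1 * tensorOperator 1 B)) := by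
  rw [← tensorOperator_mul, one_mul, mul_one]
  simp only [outcomeOperator, tensorOperator_smul_left, tensorOperator_smul_right,
    tensorOperator_add_left, tensorOperator_add_right, tensorOperator_one]
  module

variable {n : ℕ}

/-- With two outcomes, a correlation is determined by its marginal expectations and correlators, so
uniqueness reduces to these. -/
theorem bornCorrelation_apply [CompleteSpace H] {ψ : HilbertTensor H K}
    (hψ : ‖ψ‖ = 1) {A : Fin n → H →L[ℂ] H} (hA : ∀ i, IsObservable (A i)) (B : Fin n → K →L[ℂ] K)
    (a b : ℤˣ) (i j : Fin n) :
    bornCorrelation ψ A B a b i j =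
      1 / 4 * (1 + ((a : ℤ) : ℝ) * (⟪ψ, tensorOperator (A i) 1 ψ⟫_ℂ).re +
      ((b : ℤ) : ℝ) * (⟪ψ, tensorOperator 1 (B j) ψ⟫_ℂ).re +
      ((a : ℤ) : ℝ) * ((b : ℤ) : ℝ) *
        (⟪tensorOperator (A i) 1 ψ, tensorOperator 1 (B j) ψ⟫_ℂ).re) := by
  have h1 : ⟪ψ, ψ⟫_ℂ = 1 := by rw [inner_self_eq_norm_sq_to_K, hψ]; norm_num
  rw [bornCorrelation, tensorOperator_outcomeOperator]
  simp only [_root_.smul_apply, _root_.add_apply, _root_.mul_apply_eq_comp,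
    _root_.one_apply_eq_self, inner_smul_right, inner_add_right, h1,
    ((hA i).isSymmetricInvolution_left K).inner_apply_left]
  rw [(by norm_num : (1 / 4 : ℂ) = ((1 / 4 : ℝ) : ℂ)), Complex.re_ofReal_mul]
  congr 1
  simp [Complex.add_re, Complex.mul_re]

theorem correlator_bornCorrelation [CompleteSpace H] {ψ : HilbertTensor H K}
    (hψ : ‖ψ‖ = 1) {A : Fin n → H →L[ℂ] H} (hA : ∀ i, IsObservable (A i)) (B : Fin n → K →L[ℂ] K)
    (i j : Fin n) : correlator (bornCorrelation ψ A B) i j =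
      (⟪tensorOperator (A i) 1 ψ, tensorOperator 1 (B j) ψ⟫_ℂ).re := by
  have huniv : (Finset.univ : Finset ℤˣ) = {1, -1} := rfl
  have hne : (1 : ℤˣ) ≠ -1 := by decide
  simp only [correlator, bornCorrelation_apply hψ hA, huniv, Finset.sum_pair hne]
  push_cast
  ring

theorem chainedBellValue_bornCorrelation [CompleteSpace H] {ψ : HilbertTensor H K}
    (hψ : ‖ψ‖ = 1) {A : Fin n → H →L[ℂ] H} (hA : ∀ i, IsObservable (A i))
    (B : Fin n → K →L[ℂ] K) : chainedBellValue (bornCorrelation ψ A B) =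
      chainedSum (fun i => tensorOperator (A i) 1) (fun j => tensorOperator 1 (B j)) ψ := by
  simp only [chainedBellValue, correlator_bornCorrelation hψ hA, chainedSum]

end Born

/-! ### The upper bound and uniqueness of the maximizer -/

/-- The correlation with uniform marginals and correlators `cos (φ_i - φ'_j)`. -/
def cosineCorrelation (n : ℕ) : Correlation n := fun a b i j =>
  1 / 4 * (1 + ((a : ℤ) : ℝ) * ((b : ℤ) : ℝ) *
    Real.cos ((2 * (i : ℝ) - (2 * (j : ℝ) + 1)) * (Real.pi / (2 * n))))

theorem chainedBellValue_le {n : ℕ} (hn : 0 < n) {p : Correlation n}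
    (hp : p ∈ quantumCorrelations.{u, v} n) :
    chainedBellValue p ≤ 2 * n * Real.cos (Real.pi / (2 * n)) := by
  obtain ⟨H, _, _, _, K, _, _, _, ψ, A, B, hψ, hA, hB, rfl⟩ := hp
  rw [chainedBellValue_bornCorrelation hψ hA]
  exact chainedSum_le hn (fun i => (hA i).isSymmetricInvolution_left K)
    (fun j => (hB j).isSymmetricInvolution_right H) hψ

theorem eq_cosineCorrelation {n : ℕ} (hn : 2 ≤ n) {p : Correlation n}
    (hp : p ∈ quantumCorrelations.{u, v} n)
    (h : chainedBellValue p = 2 * n * Real.cos (Real.pi / (2 * n))) : p = cosineCorrelation n := by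
  obtain ⟨H, _, _, _, K, _, _, _, ψ, A, B, hψ, hA, hB, rfl⟩ := hp
  rw [chainedBellValue_bornCorrelation hψ hA] at h
  have hP := fun i => (hA i).isSymmetricInvolution_left K
  have hQ := fun j => (hB j).isSymmetricInvolution_right H
  have hPQ := fun i j => commute_tensorOperator (A i) (B j)
  funext a b i j
  rw [bornCorrelation_apply hψ hA, inner_apply_left_of_chainedSum_eq hn hP hQ hψ h hPQ i,
    inner_apply_right_of_chainedSum_eq hn hP hQ hψ h hPQ j,
    re_inner_apply_apply_of_chainedSum_eq hn hP hQ hψ h i j, cosineCorrelation]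
  simp

/-! ### The two-qubit realization -/

theorem inner_ket (k l : Fin 2) : ⟪ket k, ket l⟫_ℂ = if k = l then 1 else 0 := by
  simp [ket, EuclideanSpace.inner_single_left]

theorem inner_ket_planeObservable (θ : ℝ) (k l : Fin 2) :
    ⟪ket k, planeObservable θ (ket l)⟫_ℂ =
      ((Real.sin θ : ℂ) • pauliX + (Real.cos θ : ℂ) • pauliZ) k l := by
  simp [ket, planeObservable, EuclideanSpace.inner_single_left]

theorem planeMatrix_mul_self (θ : ℝ) :
    ((Real.sin θ : ℂ) • pauliX + (Real.cos θ : ℂ) • pauliZ) *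
      ((Real.sin θ : ℂ) • pauliX + (Real.cos θ : ℂ) • pauliZ) = 1 := by
  have h : (Real.sin θ : ℂ) * Real.sin θ + Real.cos θ * Real.cos θ = 1 := by
    have := Real.sin_sq_add_cos_sq θ
    rw [sq, sq] at this
    exact_mod_cast this
  ext i j
  fin_cases i <;> fin_cases j <;>
    simp only [pauliX, pauliZ, Matrix.mul_apply, Fin.sum_univ_two, Matrix.add_apply,
      Matrix.smul_apply, Matrix.of_apply, Matrix.cons_val', Matrix.cons_val_zero,
      Matrix.cons_val_one, smul_eq_mul, Fin.zero_eta, Fin.mk_one, Matrix.one_apply,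
      Matrix.cons_val_fin_one] <;>
    simp [-Complex.ofReal_sin, -Complex.ofReal_cos] <;>
    first | linear_combination h | ring

theorem planeMatrix_conjTranspose (θ : ℝ) :
    ((Real.sin θ : ℂ) • pauliX + (Real.cos θ : ℂ) • pauliZ).conjTranspose =
      (Real.sin θ : ℂ) • pauliX + (Real.cos θ : ℂ) • pauliZ := by
  ext i j
  fin_cases i <;> fin_cases j <;> 
    simp [pauliX, pauliZ, Matrix.conjTranspose_apply, -Complex.ofReal_sin, -Complex.ofReal_cos]

theorem isObservable_planeObservable (θ : ℝ) : IsObservable (planeObservable θ) := by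
  constructor
  · rw [IsSelfAdjoint, planeObservable, ← map_star, Matrix.star_eq_conjTranspose,
      planeMatrix_conjTranspose]
  · rw [planeObservable, ← map_mul, planeMatrix_mul_self, map_one]

theorem isObservable_referenceA (n : ℕ) (i : Fin n) : IsObservable (referenceA n i) :=
  isObservable_planeObservable _

theorem isObservable_referenceB (n : ℕ) (j : Fin n) : IsObservable (referenceB n j) :=
  isObservable_planeObservable _

variable {H : Type u} [NormedAddCommGroup H] [InnerProductSpace ℂ H]
variable {K : Type v} [NormedAddCommGroup K] [InnerProductSpace ℂ K]

/-- The maximally entangled state of two qubits, in isometric copies of the qubit space. -/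
def entangledState (e : Qubit ≃ₗᵢ[ℂ] H) (f : Qubit ≃ₗᵢ[ℂ] K) : HilbertTensor H K :=
  (((1 / √2 : ℝ) : ℂ) • (e (ket 0) ⊗ₜ[ℂ] f (ket 0) + e (ket 1) ⊗ₜ[ℂ] f (ket 1)) : H ⊗[ℂ] K)

theorem inner_entangledState (e : Qubit ≃ₗᵢ[ℂ] H) (f : Qubit ≃ₗᵢ[ℂ] K) (S : H →L[ℂ] H)
    (T : K →L[ℂ] K) : ⟪entangledState e f, tensorOperator S T (entangledState e f)⟫_ℂ =
      1 / 2 * ∑ k, ∑ l, ⟪e (ket k), S (e (ket l))⟫_ℂ * ⟪f (ket k), T (f (ket l))⟫_ℂ := by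
  have h2 : ((1 / √2 : ℝ) : ℂ) * ((1 / √2 : ℝ) : ℂ) = 1 / 2 := by
    rw [← Complex.ofReal_mul, ← sq, div_pow, Real.sq_sqrt zero_le_two]
    norm_num
  rw [entangledState, tensorOperator_coe, UniformSpace.Completion.inner_coe, map_smul]
  refine (inner_smul_left (𝕜 := ℂ) (E := H ⊗[ℂ] K) _ _ _).trans
    ((congrArg _ (inner_smul_right (𝕜 := ℂ) (E := H ⊗[ℂ] K) _ _ _)).trans ?_)
  rw [Complex.conj_ofReal, ← mul_assoc, h2, map_add]
  simp only [TensorProduct.mapL_tmul, inner_add_left, inner_add_right, TensorProduct.inner_tmul,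
    Fin.sum_univ_two]
  ring

theorem norm_entangledState (e : Qubit ≃ₗᵢ[ℂ] H) (f : Qubit ≃ₗᵢ[ℂ] K) :
    ‖entangledState e f‖ = 1 := by
  have := inner_entangledState e f 1 1
  rw [tensorOperator_one] at this
  simp only [_root_.one_apply_eq_self, LinearIsometryEquiv.inner_map_map, inner_ket,
    Fin.sum_univ_two] at this
  rw [@norm_eq_sqrt_re_inner ℂ, this]
  norm_num

variable [CompleteSpace H] [CompleteSpace K]

theorem isObservable_conj (e : Qubit ≃ₗᵢ[ℂ] H) {A : Qubit →L[ℂ] Qubit} (hA : IsObservable A) :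
    IsObservable (e.conjStarAlgEquiv A) :=
  ⟨hA.1.map e.conjStarAlgEquiv, by rw [← map_mul, hA.2, map_one]⟩

/-- Arbitrary isometric copies of the qubit let one computation serve both the reference model and
its lifts to the universes `u` and `v`. The marginals vanish because plane observables are
traceless. -/
theorem bornCorrelation_entangledState (n : ℕ) (e : Qubit ≃ₗᵢ[ℂ] H) (f : Qubit ≃ₗᵢ[ℂ] K) :
    bornCorrelation (entangledState e f) (fun i => e.conjStarAlgEquiv (referenceA n i))
      (fun j => f.conjStarAlgEquiv (referenceB n j)) = cosineCorrelation n := by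
  funext a b i j
  rw [bornCorrelation_apply (norm_entangledState e f)
    (fun i => isObservable_conj e (isObservable_referenceA n i))]
  rw [((isObservable_conj e (isObservable_referenceA n i)).isSymmetricInvolution_left
    K).inner_apply_left, ← _root_.mul_apply_eq_comp, ← tensorOperator_mul, one_mul, mul_one]
  simp only [inner_entangledState, LinearIsometryEquiv.conjStarAlgEquiv_apply_apply,
    LinearIsometryEquiv.symm_apply_apply, LinearIsometryEquiv.inner_map_map,
    _root_.one_apply_eq_self, inner_ket, referenceA, referenceB, inner_ket_planeObservable,
    Fin.sum_univ_two]
  have hang : (2 * (i : ℝ) - (2 * (j : ℝ) + 1)) * (Real.pi / (2 * n)) =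
      (i : ℝ) * Real.pi / n - (2 * (j : ℝ) + 1) * Real.pi / (2 * n) := by
    have : (n : ℝ) ≠ 0 := by exact_mod_cast (Fin.pos i).ne'
    field_simp
  rw [cosineCorrelation, hang, Real.cos_sub]
  generalize (i : ℝ) * Real.pi / n = x
  generalize (2 * (j : ℝ) + 1) * Real.pi / (2 * n) = y
  simp [pauliX, pauliZ, -Complex.ofReal_sin, -Complex.ofReal_cos]
  ring

theorem referenceCorrelation_eq (n : ℕ) : referenceCorrelation n = cosineCorrelation n :=
  bornCorrelation_entangledState n (.refl ℂ Qubit) (.refl ℂ Qubit)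

/-- A copy of the qubit space in any universe. -/
def qubitLift : Qubit ≃ₗᵢ[ℂ] EuclideanSpace ℂ (ULift.{u} (Fin 2)) :=
  LinearIsometryEquiv.piLpCongrLeft 2 ℂ ℂ Equiv.ulift.symm

theorem cosineCorrelation_mem (n : ℕ) : cosineCorrelation n ∈ quantumCorrelations.{u, v} n :=
  ⟨_, _, _, inferInstance, _, _, _, inferInstance, entangledState qubitLift.{u} qubitLift.{v}, _, _,
    norm_entangledState _ _, fun _ => isObservable_conj _ (isObservable_referenceA _ _),
    fun _ => isObservable_conj _ (isObservable_referenceB _ _),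
    (bornCorrelation_entangledState n _ _).symm⟩

theorem correlator_cosineCorrelation {n : ℕ} (i j : Fin n) :
    correlator (cosineCorrelation n) i j =
      Real.cos ((2 * (i : ℝ) - (2 * (j : ℝ) + 1)) * (Real.pi / (2 * n))) := by
  have huniv : (Finset.univ : Finset ℤˣ) = {1, -1} := rfl
  have hne : (1 : ℤˣ) ≠ -1 := by decide
  simp only [correlator, cosineCorrelation, huniv, Finset.sum_pair hne]
  push_cast
  ring

theorem chainedBellValue_cosineCorrelation (n : ℕ) :
    chainedBellValue (cosineCorrelation n) = 2 * n * Real.cos (Real.pi / (2 * n)) := by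
  have key : ∀ i : Fin n, (correlator (cosineCorrelation n) i i +
      if h : (i : ℕ) + 1 < n then correlator (cosineCorrelation n) ⟨i + 1, h⟩ i
      else -correlator (cosineCorrelation n) ⟨0, i.pos⟩ i) =
      2 * Real.cos (Real.pi / (2 * n)) := by
    intro i
    have h1 : (2 * (i : ℝ) - (2 * (i : ℝ) + 1)) * (Real.pi / (2 * n)) = -(Real.pi / (2 * n)) := by
      ring
    simp only [correlator_cosineCorrelation, h1, Real.cos_neg]
    rw [two_mul (Real.cos _)]
    congr 1
    split_ifs with h
    · push_cast
      congr 1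
      ring
    · have hn : (n : ℝ) = i + 1 := by exact_mod_cast (by omega : n = i + 1)
      have hi : (i : ℝ) + 1 ≠ 0 := by positivity
      -- At the last index the angle is π - π/(2n); the minus sign in A_{n+1} = -A_1 turns its
      -- cosine back into cos(π/(2n)).
      have h2 : (2 * (0 : ℝ) - (2 * (i : ℝ) + 1)) * (Real.pi / (2 * n)) =
          -(Real.pi - Real.pi / (2 * n)) := by
        rw [hn]
        field_simp
        ring
      rw [Nat.cast_zero, h2, Real.cos_neg, Real.cos_pi_sub, neg_neg]
  rw [chainedBellValue, Finset.sum_congr rfl fun i _ => key i]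
  simp
  ring

end ChainedBell

end

theorem mainTheorem2 (n : ℕ) (hn : 2 ≤ n) :
    IsGreatest (ChainedBell.chainedBellValue '' ChainedBell.quantumCorrelations.{u, v} n)
        (2 * (n : ℝ) * Real.cos (Real.pi / (2 * (n : ℝ)))) ∧
      {p ∈ ChainedBell.quantumCorrelations.{u, v} n |
          ChainedBell.chainedBellValue p = 2 * (n : ℝ) * Real.cos (Real.pi / (2 * (n : ℝ)))} =
        {ChainedBell.referenceCorrelation n} := by
  have hmem := ChainedBell.cosineCorrelation_mem.{u, v} n
  have hval := ChainedBell.chainedBellValue_cosineCorrelation n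
  rw [ChainedBell.referenceCorrelation_eq]
  refine ⟨⟨⟨_, hmem, hval⟩, ?_⟩, Set.eq_singleton_iff_unique_mem.2 ⟨⟨hmem, hval⟩, ?_⟩⟩
  · rintro _ ⟨p, hp, rfl⟩
    exact ChainedBell.chainedBellValue_le (by omega) hp
  · rintro p ⟨hp, h⟩
    exact ChainedBell.eq_cosineCorrelation hn hp h
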